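/- Let $d\ge 1$ be an integer and $p>2$, $\kappa>d$, $C>0$ real numbers. Let $[N]=\{0,1,\dots,N-1\}$. Call $S\subseteq[N]^d$ a $\Lambda(p)$-set with constant $C$ if $$\Big\|\sum_{s\in S}c_s e^{2\pi i s\cdot x}\Big\|_{L^p([0,1]^d)}\le C\Big(\sum_{s\in S}|c_s|^2\Big)^{1/2}\qquad\text{for all }(c_s)_{s\in S}\subset\mathbb C.$$ Let $(n_j)_{j\ge1}$ be a sequence of positive integers, $N_0=1$, $N_k=n_1\cdots n_k$, $A_0=\{0\}$. Suppose that for every $k\ge0$ and every $a\in A_k$ a $\Lambda(p)$-set $S_{k+1,a}\subseteq[n_{k+1}]^d$ with constant $C$ has been chosen, where inductively $$A_{k+1}=\bigcup_{a\in A_k}\big(a+N_{k+1}^{-1}S_{k+1,a}\big).$$ For $a\in A_k$ put $\tau_{k,a}=a+[0,N_k^{-1}]^d$, and let $E_k=\bigcup_{a\in A_k}\tau_{k,a}$. An $R$-cube is a closed cube in $\mathbb R^d$ of side length $R$ with sides parallel to the coordinate hyperplanes. For an $R$-cube $I$ with centre $c$ let $w_I(x)=(1+|x-c|/R)^{-\kappa}$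 and $\|F\|_{L^p(w_I)}=\big(\int_{\mathbb R^d}|F|^pw_I\big)^{1/p}$. **Proposition.** There is a constant $C_0$, depending only on $d,p,\kappa$ and $C$, such that for all sequences $(n_j)$ and alphabets $S_{k+1,a}$ as above the following holds. Let $k\ge1$, let $J$ be an $N_k$-cube, and let $\mathcal I$ be a finite collection of $1$-cubes with union $J$ and pairwise disjoint interiors. Let $g$ be integrable on $\mathbb R^d$ and vanish outside $E_k$, let $f(x)=\int g(\xi)e^{2\pi i x\cdot\xi}\,d\xi$ for almost every $x$ (so that $\widehat f=g$), and for $a\in A_k$ let $f_{k,a}(x)=\int_{\tau_{k,a}} g(\xi)e^{2\pi i x\cdot\xi}\,d\xi$ (so that $\widehat{f_{k,a}}=\mathbf 1_{\tau_{k,a}}\widehat f$). Then $$\Big(\sum_{I\in\mathcal I}\|f\|_{L^p(w_I)}^p\Big)^{1/p}\le C_0^{\,k}\Big(\sum_{a\in A_k}\|f_{k,a}\|_{L^p(w_J)}^2\Big)^{1/2}.$$ -/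

import Mathlib

open MeasureTheory
open scoped ENNReal NNReal FourierTransform

noncomputable section

namespace CantorDecoupling

variable {d : ℕ}

/-- The closed cube with sides parallel to the axes, centre `c` and side length `R`. -/
def cube (c : EuclideanSpace ℝ (Fin d)) (R : ℝ) : Set (EuclideanSpace ℝ (Fin d)) :=
  {x | ∀ i, c i - R / 2 ≤ x i ∧ x i ≤ c i + R / 2}

/-- The closed cube `a + [0, r]^d`. -/
def cornerCube (a : EuclideanSpace ℝ (Fin d)) (r : ℝ) : Set (EuclideanSpace ℝ (Fin d)) :=
  {x | ∀ i, a i ≤ x i ∧ x i ≤ a i + r}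

/-- The weight `(1 + |x - c| / R)^(-κ)` adapted to the `R`-cube centred at `c`
(`|·|` is the Euclidean norm). -/
def weight (κ : ℝ) (c : EuclideanSpace ℝ (Fin d)) (R : ℝ) (x : EuclideanSpace ℝ (Fin d)) : ℝ :=
  (1 + ‖x - c‖ / R) ^ (-κ)

/-- The (non-normalised) weighted norm `(∫ |F|^p w)^(1/p)`, where `w` is the weight of the
`R`-cube centred at `c`. -/
def weightedNorm (κ p : ℝ) (c : EuclideanSpace ℝ (Fin d)) (R : ℝ)
    (F : EuclideanSpace ℝ (Fin d) → ℂ) : ℝ≥0∞ :=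
  eLpNorm F (ENNReal.ofReal p)
    ((volume : Measure (EuclideanSpace ℝ (Fin d))).withDensity
      fun x => ENNReal.ofReal (weight κ c R x))

/-- The unit cubes centred at the points of `𝓘` tile the `R`-cube centred at `c`: their union is
that cube, and their interiors are pairwise disjoint. -/
def IsUnitTiling (𝓘 : Finset (EuclideanSpace ℝ (Fin d))) (c : EuclideanSpace ℝ (Fin d))
    (R : ℝ) : Prop :=
  (⋃ b ∈ 𝓘, cube b 1) = cube c R ∧
    (𝓘 : Set (EuclideanSpace ℝ (Fin d))).Pairwise
      fun b b' => Disjoint (interior (cube b 1)) (interior (cube b' 1))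

/-- An integer vector as a point of Euclidean space. -/
def toPoint (s : Fin d → ℕ) : EuclideanSpace ℝ (Fin d) :=
  WithLp.toLp 2 fun i => (s i : ℝ)

/-- `S ⊆ {0, …, N - 1}^d` is a `Λ(p)`-set with constant `C`:
`‖∑_{a ∈ S} c_a e^{2πi a·x}‖_{L^p([0,1]^d)} ≤ C (∑_{a ∈ S} |c_a|²)^{1/2}`
for all complex coefficients. -/
def IsLambdaSet (p C : ℝ) (N : ℕ) (S : Finset (Fin d → ℕ)) : Prop :=
  (∀ s ∈ S, ∀ i, s i < N) ∧
    ∀ c : (Fin d → ℕ) → ℂ,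
      eLpNorm
          (fun x : EuclideanSpace ℝ (Fin d) =>
            ∑ s ∈ S, c s * Complex.exp (2 * Real.pi * Complex.I * (∑ i, (s i : ℝ) * x i : ℝ)))
          (ENNReal.ofReal p) (volume.restrict (cornerCube 0 1))
        ≤ ENNReal.ofReal (C * Real.sqrt (∑ s ∈ S, ‖c s‖ ^ 2))

/-- `N_k = n_1 ⋯ n_k`. Sequences are indexed from `0`: `n j` is the `(j+1)`-st term. -/
def scale (n : ℕ → ℕ) (k : ℕ) : ℕ := ∏ j ∈ Finset.range k, n j

open Classical in
/-- The set `A_k` of corners: `A_0 = {0}` and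
`A_{k+1} = ⋃_{a ∈ A_k} (a + N_{k+1}⁻¹ S_{k+1,a})`. Here `S k a` is the alphabet `S_{k+1,a}` used
to pass from stage `k` to stage `k + 1` below the corner `a`. -/
def corners (n : ℕ → ℕ) (S : ℕ → EuclideanSpace ℝ (Fin d) → Finset (Fin d → ℕ)) :
    ℕ → Finset (EuclideanSpace ℝ (Fin d))
  | 0 => {0}
  | k + 1 => (corners n S k).biUnion fun a =>
      (S k a).image fun s => a + ((scale n (k + 1) : ℝ)⁻¹) • toPoint s

/-- The cube `τ_{k,a} = a + [0, N_k⁻¹]^d`. -/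
def stageCube (n : ℕ → ℕ) (k : ℕ) (a : EuclideanSpace ℝ (Fin d)) :
    Set (EuclideanSpace ℝ (Fin d)) :=
  cornerCube a ((scale n k : ℝ)⁻¹)

/-- The `k`-th stage `E_k = A_k + [0, N_k⁻¹]^d` of the Cantor construction. -/
def stage (n : ℕ → ℕ) (S : ℕ → EuclideanSpace ℝ (Fin d) → Finset (Fin d → ℕ)) (k : ℕ) :
    Set (EuclideanSpace ℝ (Fin d)) :=
  ⋃ a ∈ corners n S k, stageCube n k a

/-- The data `(n, S)` define a multiscale Cantor set all of whose alphabets are `Λ(p)`-sets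
with the same constant `C`. -/
def IsLambdaCantor (p C : ℝ) (n : ℕ → ℕ)
    (S : ℕ → EuclideanSpace ℝ (Fin d) → Finset (Fin d → ℕ)) : Prop :=
  (∀ j, 0 < n j) ∧ ∀ j, ∀ a ∈ corners n S j, IsLambdaSet p C (n j) (S j a)

/-- `f` has Fourier transform the integrable function `g`, that is
`f(x) = ∫ g(ξ) e^{2πi x·ξ} dξ` for almost every `x`. -/
def HasFourierDensity (f g : EuclideanSpace ℝ (Fin d) → ℂ) : Prop :=
  Integrable g ∧ f =ᵐ[volume] 𝓕⁻ g

/-- The frequency piece with Fourier transform `1_τ g`. -/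
def piece (g : EuclideanSpace ℝ (Fin d) → ℂ) (τ : Set (EuclideanSpace ℝ (Fin d))) :
    EuclideanSpace ℝ (Fin d) → ℂ :=
  𝓕⁻ (τ.indicator g)

end CantorDecoupling

end

open CantorDecoupling

/-!
The multiscale estimate is an iteration of a single-scale one, and both are proved with one fixed
weight, that of the large cube `J` of side `N_k`.

*Unit cubes.* Since `κ > d`, the weights of the unit cubes tiling `J` add up to at most a constant
times the weight of `J` (`sum_weightedNorm_rpow_le`). This reduces the left-hand side to
`‖f‖_{L^p(w_J)}` at the cost of a single constant.

*One scale.* Let `F = ∑ F_s` with `F_s` of frequency in the cube of side `R⁻¹` at `a + R⁻¹ s`, where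
`s` runs over a `Λ(p)`-set, and let `R ≤ N_k`. A Schwartz function `ψ` with `𝓕 ψ = 1` on `[0,1]^d`
reproduces each `F_s` after rescaling and modulation, and therefore
`F(x + R u) = ∫ ψ(u + v) e(R (u + v)·a) ∑_s e(u·s) e(v·s) F_s(x - R v) dv`.
For `u ∈ [0,1]^d` the kernel has a majorant rapidly decreasing in `v` and independent of `u`, so
Hölder in `v` and then the `Λ(p)` inequality in `u` bound the average of `|F(x + R u)|^p` over `u`
by a weighted average of `(∑ |F_s|²)^{p/2}` at the points `x - R v`. The weight `w_J` varies slowly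
at scale `R ≤ N_k` (Peetre's inequality), so translations by `R u` and `R v` cost only powers of
`1 + |u|` and `1 + |v|`, which the kernel absorbs. This is a weighted square function estimate
(`lintegral_sum_fourierInv_le`), and Minkowski's inequality with exponent `p / 2 ≥ 1` turns it into
decoupling (`weightedNorm_sum_fourierInv_le`).

*Iteration.* Up to boundaries, which lie in finitely many families of hyperplanes and are null, the
cube of a corner contains exactly the part of the support of `g` carried by its children, so a piece
at stage `j` is the sum of its children (`piece_eq_sum`), and the single-scale estimate with
`R = N_{j+1}` applies to it. Summing over corners and iterating from stage `0` to stage `k` gives the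
theorem (`weightedNorm_fourierInv_le`).
-/

namespace CantorDecoupling

variable {d : ℕ}

/-! ### Weights and cubes -/

lemma weight_pos (κ : ℝ) (c : EuclideanSpace ℝ (Fin d)) {R : ℝ} (hR : 0 < R)
    (x : EuclideanSpace ℝ (Fin d)) : 0 < weight κ c R x := by
  unfold weight
  positivity

lemma continuous_weight (κ : ℝ) (c : EuclideanSpace ℝ (Fin d)) {R : ℝ} (hR : 0 < R) :
    Continuous (weight κ c R) := by
  unfold weight
  refine Continuous.rpow_const (by fun_prop) fun x => Or.inl ?_
  positivity

/-- Peetre's inequality: the weight varies slowly at the scale of its cube. -/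
lemma weight_le_mul_weight {κ : ℝ} (hκ : 0 ≤ κ) (c : EuclideanSpace ℝ (Fin d)) {R : ℝ}
    (hR : 0 < R) (x y : EuclideanSpace ℝ (Fin d)) :
    weight κ c R x ≤ (1 + ‖x - y‖ / R) ^ κ * weight κ c R y := by
  unfold weight
  have hx : 0 < 1 + ‖x - c‖ / R := by positivity
  have hy : 0 < 1 + ‖y - c‖ / R := by positivity
  rw [Real.rpow_neg hx.le, Real.rpow_neg hy.le, ← div_eq_mul_inv, inv_le_comm₀ (by positivity)
    (by positivity), inv_div, div_le_iff₀ (by positivity), ← Real.mul_rpow hx.le (by positivity)]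
  refine Real.rpow_le_rpow hy.le ?_ hκ
  have h1 : ‖y - c‖ / R ≤ ‖x - c‖ / R + ‖x - y‖ / R := by
    rw [← add_div]
    gcongr
    calc ‖y - c‖ = ‖(x - c) - (x - y)‖ := by congr 1; abel
      _ ≤ _ := norm_sub_le _ _
  have h2 : 0 ≤ (‖x - c‖ / R) * (‖x - y‖ / R) := by positivity
  nlinarith

lemma weight_add_smul_le {κ : ℝ} (hκ : 0 ≤ κ) (c : EuclideanSpace ℝ (Fin d)) {R M : ℝ}
    (hR : 0 < R) (hRM : R ≤ M) (x v : EuclideanSpace ℝ (Fin d)) :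
    weight κ c M (x + R • v) ≤ (1 + ‖v‖) ^ κ * weight κ c M x := by
  have hM : 0 < M := hR.trans_le hRM
  refine (weight_le_mul_weight hκ c hM (x + R • v) x).trans ?_
  refine mul_le_mul_of_nonneg_right ?_ (weight_pos κ c hM x).le
  refine Real.rpow_le_rpow (by positivity) ?_ hκ
  rw [add_sub_cancel_left, norm_smul, Real.norm_of_nonneg hR.le, mul_div_right_comm]
  have : R / M ≤ 1 := (div_le_one hM).2 hRM
  nlinarith [norm_nonneg v]

lemma norm_le_sqrt_mul {r : ℝ} (hr : 0 ≤ r) {x : EuclideanSpace ℝ (Fin d)}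
    (h : ∀ i, |x i| ≤ r) : ‖x‖ ≤ √d * r := by
  rw [EuclideanSpace.norm_eq]
  calc √(∑ i, ‖x i‖ ^ 2) ≤ √(∑ _i : Fin d, r ^ 2) := by
        gcongr with i
        exact h i
    _ = √d * r := by simp [Real.sqrt_sq hr]

lemma norm_le_of_mem_cornerCube {u : EuclideanSpace ℝ (Fin d)} (hu : u ∈ cornerCube 0 1) :
    ‖u‖ ≤ √d := by
  simpa using norm_le_sqrt_mul zero_le_one (x := u) fun i => by
    have := hu i
    simp only [PiLp.zero_apply, zero_add] at this
    exact abs_le.2 ⟨by linarith, this.2⟩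

lemma norm_sub_le_of_mem_cube {c x : EuclideanSpace ℝ (Fin d)} {R : ℝ} (hR : 0 ≤ R)
    (hx : x ∈ cube c R) : ‖x - c‖ ≤ √d * R := by
  refine norm_le_sqrt_mul hR fun i => ?_
  have := hx i
  rw [PiLp.sub_apply, abs_le]
  constructor <;> linarith

lemma volume_ofLp_preimage (s : Set (Fin d → ℝ)) (hs : MeasurableSet s) :
    volume ((fun x : EuclideanSpace ℝ (Fin d) => WithLp.ofLp x) ⁻¹' s) = volume s :=
  (PiLp.volume_preserving_ofLp (Fin d)).measure_preimage hs.nullMeasurableSet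

lemma cube_eq_preimage (c : EuclideanSpace ℝ (Fin d)) (R : ℝ) :
    cube c R = (fun x : EuclideanSpace ℝ (Fin d) => WithLp.ofLp x) ⁻¹'
      Set.Icc (fun i => c i - R / 2) (fun i => c i + R / 2) := by
  ext x
  simp [cube, Pi.le_def, forall_and]

lemma cornerCube_eq_preimage (a : EuclideanSpace ℝ (Fin d)) (r : ℝ) :
    cornerCube a r = (fun x : EuclideanSpace ℝ (Fin d) => WithLp.ofLp x) ⁻¹'
      Set.Icc (fun i => a i) (fun i => a i + r) := by
  ext x
  simp [cornerCube, Pi.le_def, forall_and]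

lemma measurableSet_cube (c : EuclideanSpace ℝ (Fin d)) (R : ℝ) : MeasurableSet (cube c R) := by
  rw [cube_eq_preimage]
  exact (PiLp.volume_preserving_ofLp (Fin d)).measurable measurableSet_Icc

lemma measurableSet_cornerCube (a : EuclideanSpace ℝ (Fin d)) (r : ℝ) :
    MeasurableSet (cornerCube a r) := by
  rw [cornerCube_eq_preimage]
  exact (PiLp.volume_preserving_ofLp (Fin d)).measurable measurableSet_Icc

lemma volume_cube (c : EuclideanSpace ℝ (Fin d)) (R : ℝ) :
    volume (cube c R) = ENNReal.ofReal R ^ d := by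
  rw [cube_eq_preimage, volume_ofLp_preimage _ measurableSet_Icc, Real.volume_Icc_pi]
  simp

lemma volume_cornerCube (a : EuclideanSpace ℝ (Fin d)) (r : ℝ) :
    volume (cornerCube a r) = ENNReal.ofReal r ^ d := by
  rw [cornerCube_eq_preimage, volume_ofLp_preimage _ measurableSet_Icc, Real.volume_Icc_pi]
  simp

lemma volume_interior_cube (c : EuclideanSpace ℝ (Fin d)) (R : ℝ) :
    volume (interior (cube c R)) = ENNReal.ofReal R ^ d := by
  have h : (interior (cube c R)) = (fun x : EuclideanSpace ℝ (Fin d) => WithLp.ofLp x) ⁻¹'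
      interior (Set.Icc (fun i => c i - R / 2) (fun i => c i + R / 2)) := by
    rw [cube_eq_preimage]
    exact ((PiLp.homeomorph 2 (fun _ : Fin d => ℝ)).preimage_interior _).symm
  rw [h, volume_ofLp_preimage _ isOpen_interior.measurableSet, ← Set.pi_univ_Icc,
    interior_pi_set Set.finite_univ]
  simp only [interior_Icc]
  rw [volume_pi_pi]
  simp

/-! ### A reproducing kernel for the unit cube -/

/-- A Schwartz function whose Fourier transform is identically `1` on `[0, 1]^d`. -/
lemma exists_schwartz_fourier_eq_one (d : ℕ) :
    ∃ ψ : SchwartzMap (EuclideanSpace ℝ (Fin d)) ℂ,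
      ∀ η ∈ cornerCube (0 : EuclideanSpace ℝ (Fin d)) 1,
        𝓕 (ψ : EuclideanSpace ℝ (Fin d) → ℂ) η = 1 := by
  let b : ContDiffBump (0 : EuclideanSpace ℝ (Fin d)) :=
    ⟨√d + 1, √d + 2, by positivity, by linarith⟩
  have hs : HasCompactSupport fun x => (b x : ℂ) :=
    b.hasCompactSupport.comp_left Complex.ofReal_zero
  have hc : ContDiff ℝ (⊤ : ℕ∞) fun x => (b x : ℂ) := Complex.ofRealCLM.contDiff.comp b.contDiff
  refine ⟨𝓕⁻ (hs.toSchwartzMap hc), fun η hη => ?_⟩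
  rw [← SchwartzMap.fourier_coe, FourierTransform.fourier_fourierInv_eq]
  have : b η = 1 := b.one_of_mem_closedBall <| by
    rw [mem_closedBall_zero_iff]
    exact (norm_le_of_mem_cornerCube hη).trans (by simp [b])
  simp [this]

lemma schwartz_decay (ψ : SchwartzMap (EuclideanSpace ℝ (Fin d)) ℂ) (L : ℝ) :
    ∃ B : ℝ, 0 < B ∧ ∀ z, ‖ψ z‖ ≤ B * (1 + ‖z‖) ^ (-L) := by
  obtain ⟨n, hn⟩ := exists_nat_ge L
  obtain ⟨B, hB⟩ : ∃ B : ℝ, ∀ z, (1 + ‖z‖) ^ n * ‖ψ z‖ ≤ B := by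
    refine ⟨2 ^ n * (Finset.Iic (n, 0)).sup (fun m => SchwartzMap.seminorm ℝ m.1 m.2) ψ,
      fun z => ?_⟩
    simpa using SchwartzMap.one_add_le_sup_seminorm_apply (𝕜 := ℝ) (m := (n, 0)) le_rfl le_rfl ψ z
  refine ⟨max B 1, by positivity, fun z => ?_⟩
  have h1 : (1 : ℝ) ≤ 1 + ‖z‖ := by linarith [norm_nonneg z]
  have h2 : (1 + ‖z‖) ^ L ≤ (1 + ‖z‖) ^ n := by
    rw [← Real.rpow_natCast]
    exact Real.rpow_le_rpow_of_exponent_le h1 hn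
  rw [Real.rpow_neg (by positivity), ← div_eq_mul_inv, le_div_iff₀ (by positivity), mul_comm]
  calc _ ≤ (1 + ‖z‖) ^ n * ‖ψ z‖ := by gcongr
    _ ≤ _ := (hB z).trans (le_max_left _ _)

lemma continuous_fourierInv {h : EuclideanSpace ℝ (Fin d) → ℂ} (hh : Integrable h) :
    Continuous (𝓕⁻ h) :=
  VectorFourier.fourierIntegral_continuous Real.continuous_fourierChar
    (by simp only [LinearMap.neg_apply, innerₗ_apply_apply]; fun_prop) hh

lemma continuous_fourierChar_coe : Continuous fun t : ℝ => (Real.fourierChar t : ℂ) := by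
  simp only [Real.fourierChar_apply]
  fun_prop

/-- A function with frequencies in the cube of side `R⁻¹` at `α` is reproduced by convolution
with the modulated and rescaled kernel: on the frequency side, the multiplier
`ξ ↦ 𝓕 ψ (R (ξ - α))` equals `1` on that cube. -/
lemma fourierInv_eq_integral_kernel {ψ : SchwartzMap (EuclideanSpace ℝ (Fin d)) ℂ}
    (hψ : ∀ η ∈ cornerCube (0 : EuclideanSpace ℝ (Fin d)) 1,
      𝓕 (ψ : EuclideanSpace ℝ (Fin d) → ℂ) η = 1)
    {R : ℝ} (hR : 0 < R) (α : EuclideanSpace ℝ (Fin d)) {h : EuclideanSpace ℝ (Fin d) → ℂ}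
    (hh : Integrable h) (hs : Function.support h ⊆ cornerCube α R⁻¹)
    (x : EuclideanSpace ℝ (Fin d)) :
    𝓕⁻ h x = ∫ z, ψ z * ((Real.fourierChar (inner ℝ (R • z) α) : ℂ) * 𝓕⁻ h (x - R • z)) := by
  have hint : Integrable (Function.uncurry fun (ξ z : EuclideanSpace ℝ (Fin d)) =>
      (Real.fourierChar (inner ℝ ξ x + inner ℝ (R • z) (α - ξ)) : ℂ) * (h ξ * ψ z))
      (volume.prod volume) := by
    refine (hh.mul_prod ψ.integrable).bdd_mul (c := 1) ?_ ?_
    · exact (continuous_fourierChar_coe.comp (by fun_prop)).aestronglyMeasurable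
    · exact .of_forall fun _ => (Circle.norm_coe _).le
  have key : ∀ ξ, (Real.fourierChar (inner ℝ ξ x) : ℂ) * h ξ =
      ∫ z, (Real.fourierChar (inner ℝ ξ x + inner ℝ (R • z) (α - ξ)) : ℂ) * (h ξ * ψ z) := by
    intro ξ
    by_cases hξ : h ξ = 0
    · simp [hξ]
    have hη : R • (ξ - α) ∈ cornerCube (0 : EuclideanSpace ℝ (Fin d)) 1 := by
      intro i
      have := hs (Function.mem_support.2 hξ) i
      simp only [PiLp.zero_apply, PiLp.smul_apply, PiLp.sub_apply, smul_eq_mul, zero_add]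
      constructor
      · exact mul_nonneg hR.le (by linarith)
      · calc R * (ξ i - α i) ≤ R * R⁻¹ := by gcongr; linarith
          _ = 1 := mul_inv_cancel₀ hR.ne'
    have h1 := hψ _ hη
    rw [Real.fourier_eq] at h1
    calc _ = (Real.fourierChar (inner ℝ ξ x) : ℂ) * h ξ *
          ∫ v, Real.fourierChar (-inner ℝ v (R • (ξ - α))) • ψ v := by rw [h1, mul_one]
      _ = _ := by
        rw [← integral_const_mul]
        refine integral_congr_ae (.of_forall fun z => ?_)
        simp only [Circle.smul_def, smul_eq_mul, AddChar.map_add_eq_mul, Circle.coe_mul]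
        have : -inner ℝ z (R • (ξ - α)) = inner ℝ (R • z) (α - ξ) := by
          rw [real_inner_smul_left, real_inner_smul_right, ← neg_sub ξ α, inner_neg_right]
          ring
        rw [this]
        ring
  rw [Real.fourierInv_eq]
  simp only [Circle.smul_def, smul_eq_mul]
  rw [integral_congr_ae (.of_forall key), integral_integral_swap hint]
  refine integral_congr_ae (.of_forall fun z => ?_)
  simp only
  rw [Real.fourierInv_eq, ← mul_assoc, ← integral_const_mul]
  refine integral_congr_ae (.of_forall fun ξ => ?_)
  simp only [Circle.smul_def, smul_eq_mul, AddChar.map_add_eq_mul, Circle.coe_mul,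
    sub_eq_add_neg, inner_add_right, inner_neg_right, real_inner_comm ξ (R • z)]
  ring

/-! ### Decoupling at a single scale -/

/-- Jensen's inequality for the `p`-th power with respect to a non-normalised measure. -/
lemma rpow_lintegral_le {α : Type*} [MeasurableSpace α] (μ : Measure α) {h : α → ℝ≥0∞}
    (hh : AEMeasurable h μ) {p : ℝ} (hp : 1 < p) :
    (∫⁻ x, h x ∂μ) ^ p ≤ μ Set.univ ^ (p - 1) * ∫⁻ x, h x ^ p ∂μ := by
  have hp0 : 0 < p := by linarith
  have hpq := Real.HolderConjugate.conjExponent hp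
  have h1 := ENNReal.lintegral_mul_le_Lp_mul_Lq μ hpq hh (aemeasurable_const (b := (1 : ℝ≥0∞)))
  simp only [Pi.mul_apply, mul_one, ENNReal.one_rpow, lintegral_one] at h1
  refine (ENNReal.rpow_le_rpow h1 hp0.le).trans_eq ?_
  rw [ENNReal.mul_rpow_of_nonneg _ _ hp0.le, ← ENNReal.rpow_mul, ← ENNReal.rpow_mul, mul_comm,
    one_div_mul_cancel hp0.ne', ENNReal.rpow_one]
  congr 2
  rw [Real.conjExponent]
  field_simp

/-- The defining inequality of a `Λ(p)`-set, raised to the power `p`. -/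
lemma IsLambdaSet.lintegral_le {p C : ℝ} (hp : 2 < p) (hC : 0 < C) {N : ℕ}
    {S : Finset (Fin d → ℕ)} (hS : IsLambdaSet p C N S) (c : (Fin d → ℕ) → ℂ) :
    ∫⁻ u in cornerCube (0 : EuclideanSpace ℝ (Fin d)) 1,
        ‖∑ s ∈ S, (Real.fourierChar (inner ℝ u (toPoint s)) : ℂ) * c s‖ₑ ^ p ≤
      ENNReal.ofReal C ^ p * (∑ s ∈ S, ‖c s‖ₑ ^ (2 : ℝ)) ^ (p / 2) := by
  have hp0 : 0 < p := by linarith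
  have h := hS.2 c
  rw [eLpNorm_eq_lintegral_rpow_enorm_toReal (by simpa using hp0) ENNReal.ofReal_ne_top,
    ENNReal.toReal_ofReal hp0.le, one_div, ENNReal.rpow_inv_le_iff hp0] at h
  refine le_trans (le_of_eq ?_) (h.trans_eq ?_)
  · refine lintegral_congr fun u => ?_
    congr 2
    refine Finset.sum_congr rfl fun s _ => ?_
    rw [mul_comm, Real.fourierChar_apply]
    congr 2
    have : inner ℝ u (toPoint s) = ∑ i, (s i : ℝ) * u i := by
      simp [PiLp.inner_apply, toPoint]
    rw [this]
    push_cast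
    ring
  · rw [ENNReal.ofReal_mul hC.le, ENNReal.mul_rpow_of_nonneg _ _ hp0.le]
    congr 1
    have h0 : 0 ≤ ∑ s ∈ S, ‖c s‖ ^ 2 := Finset.sum_nonneg fun _ _ => by positivity
    rw [Real.sqrt_eq_rpow, ← ENNReal.ofReal_rpow_of_nonneg h0 (by norm_num), ← ENNReal.rpow_mul,
      ENNReal.ofReal_sum_of_nonneg fun _ _ => by positivity]
    congr 1
    · refine Finset.sum_congr rfl fun s _ => ?_
      rw [ENNReal.ofReal_pow (norm_nonneg _), ofReal_norm]
      norm_num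
    · ring

/-- The measure with density `(1 + |v|)^(-L)`. -/
noncomputable def decayMeasure (d : ℕ) (L : ℝ) : Measure (EuclideanSpace ℝ (Fin d)) :=
  (volume : Measure (EuclideanSpace ℝ (Fin d))).withDensity
    fun v => ENNReal.ofReal ((1 + ‖v‖) ^ (-L))

instance (L : ℝ) : SFinite (decayMeasure d L) := by
  unfold decayMeasure
  infer_instance

lemma continuous_one_add_norm_rpow (r : ℝ) :
    Continuous fun v : EuclideanSpace ℝ (Fin d) => (1 + ‖v‖) ^ r :=
  Continuous.rpow_const (by fun_prop) fun v => Or.inl (by positivity)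

lemma lintegral_one_add_norm_lt_top {r : ℝ} (hr : (d : ℝ) < r) :
    ∫⁻ v : EuclideanSpace ℝ (Fin d), ENNReal.ofReal ((1 + ‖v‖) ^ (-r)) < ∞ :=
  finite_integral_one_add_norm (by simpa using hr)

lemma lintegral_decayMeasure (L : ℝ) {h : EuclideanSpace ℝ (Fin d) → ℝ≥0∞} (hh : Measurable h) :
    ∫⁻ v, h v ∂(decayMeasure d L) = ∫⁻ v, ENNReal.ofReal ((1 + ‖v‖) ^ (-L)) * h v := by
  rw [decayMeasure, lintegral_withDensity_eq_lintegral_mul _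
    (continuous_one_add_norm_rpow (-L)).measurable.ennreal_ofReal hh]
  rfl

lemma norm_fourierInv_le (h : EuclideanSpace ℝ (Fin d) → ℂ) (x : EuclideanSpace ℝ (Fin d)) :
    ‖𝓕⁻ h x‖ ≤ ∫ ξ, ‖h ξ‖ :=
  VectorFourier.norm_fourierIntegral_le_integral_norm _ _ _ _ _

lemma enorm_circle_coe (z : Circle) : ‖(z : ℂ)‖ₑ = 1 := by
  rw [← ofReal_norm, Circle.norm_coe, ENNReal.ofReal_one]

/-- Near a point `x`, at the scale `R` dual to the frequency cubes, the sum of the pieces is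
controlled by exponential sums with coefficients that do not depend on the point `x + R u`. -/
lemma enorm_sum_fourierInv_le (d : ℕ) {L : ℝ} (hL : 0 ≤ L) :
    ∃ B : ℝ≥0, ∀ (S : Finset (Fin d → ℕ)) (R : ℝ), 0 < R →
      ∀ (a : EuclideanSpace ℝ (Fin d)) (h : (Fin d → ℕ) → EuclideanSpace ℝ (Fin d) → ℂ),
      (∀ s ∈ S, Integrable (h s)) →
      (∀ s ∈ S, Function.support (h s) ⊆ cornerCube (a + R⁻¹ • toPoint s) R⁻¹) →
      ∀ x, ∀ u ∈ cornerCube (0 : EuclideanSpace ℝ (Fin d)) 1,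
        ‖∑ s ∈ S, 𝓕⁻ (h s) (x + R • u)‖ₑ ≤ B * ∫⁻ v, ‖∑ s ∈ S,
          (Real.fourierChar (inner ℝ u (toPoint s)) : ℂ) *
            ((Real.fourierChar (inner ℝ v (toPoint s)) : ℂ) * 𝓕⁻ (h s) (x - R • v))‖ₑ
          ∂(decayMeasure d L) := by
  obtain ⟨ψ, hψ⟩ := exists_schwartz_fourier_eq_one d
  obtain ⟨B, hB, hψB⟩ := schwartz_decay ψ L
  refine ⟨(B * (1 + √d) ^ L).toNNReal, fun S R hR a h hi hs x u hu => ?_⟩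
  set T : EuclideanSpace ℝ (Fin d) → ℂ := fun v => ∑ s ∈ S,
    (Real.fourierChar (inner ℝ u (toPoint s)) : ℂ) *
      ((Real.fourierChar (inner ℝ v (toPoint s)) : ℂ) * 𝓕⁻ (h s) (x - R • v)) with hT
  have hTm : Measurable fun v => ‖T v‖ₑ := by
    refine (Continuous.enorm ?_).measurable
    refine continuous_finsetSum _ fun s hsS => continuous_const.mul ?_
    exact (continuous_fourierChar_coe.comp (by fun_prop)).mul
      ((continuous_fourierInv (hi s hsS)).comp (by fun_prop))
  have hsum : ∑ s ∈ S, 𝓕⁻ (h s) (x + R • u) =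
      ∫ v, ψ (u + v) * ((Real.fourierChar (inner ℝ (R • (u + v)) a) : ℂ) * T v) := by
    have h1 : ∀ s ∈ S, 𝓕⁻ (h s) (x + R • u) = ∫ v, ψ (u + v) *
        ((Real.fourierChar (inner ℝ (R • (u + v)) (a + R⁻¹ • toPoint s)) : ℂ) *
          𝓕⁻ (h s) (x - R • v)) := by
      intro s hsS
      rw [fourierInv_eq_integral_kernel hψ hR _ (hi s hsS) (hs s hsS),
        ← integral_add_left_eq_self _ u]
      refine integral_congr_ae (.of_forall fun v => ?_)
      have : x + R • u - R • (u + v) = x - R • v := by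
        rw [smul_add]
        abel
      simp only [this]
    rw [Finset.sum_congr rfl h1, ← integral_finsetSum]
    · refine integral_congr_ae (.of_forall fun v => ?_)
      simp only [hT, Finset.mul_sum]
      refine Finset.sum_congr rfl fun s _ => ?_
      have : inner ℝ (R • (u + v)) (a + R⁻¹ • toPoint s) =
          inner ℝ (R • (u + v)) a + (inner ℝ u (toPoint s) + inner ℝ v (toPoint s)) := by
        rw [inner_add_right, real_inner_smul_right, real_inner_smul_left _ (toPoint s),
          inv_mul_cancel_left₀ hR.ne', inner_add_left u v (toPoint s)]
      rw [this, AddChar.map_add_eq_mul, AddChar.map_add_eq_mul, Circle.coe_mul, Circle.coe_mul]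
      ring
    · intro s hsS
      refine (ψ.integrable.comp_add_left u).mul_bdd (c := ∫ ξ, ‖h s ξ‖) ?_ ?_
      · exact ((continuous_fourierChar_coe.comp (by fun_prop)).mul
          ((continuous_fourierInv (hi s hsS)).comp (by fun_prop))).aestronglyMeasurable
      · refine .of_forall fun v => ?_
        rw [norm_mul, Circle.norm_coe, one_mul]
        exact norm_fourierInv_le _ _
  rw [hsum, lintegral_decayMeasure L hTm, ← lintegral_const_mul' _ _ ENNReal.coe_ne_top]
  refine (enorm_integral_le_lintegral_enorm _).trans (lintegral_mono fun v => ?_)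
  simp only
  rw [enorm_mul, enorm_mul, enorm_circle_coe, one_mul, ← mul_assoc]
  gcongr
  change _ ≤ ENNReal.ofReal _ * _
  rw [← ofReal_norm, ← ENNReal.ofReal_mul (by positivity)]
  refine ENNReal.ofReal_le_ofReal ((hψB _).trans ?_)
  rw [mul_assoc]
  gcongr
  have hv : 1 + ‖v‖ ≤ (1 + √d) * (1 + ‖u + v‖) := by
    have h1 : ‖v‖ ≤ ‖u + v‖ + ‖u‖ := by
      simpa using norm_sub_le (u + v) u
    have h2 := norm_le_of_mem_cornerCube hu
    have h3 : 0 ≤ √d * ‖u + v‖ := by positivity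
    nlinarith
  rw [Real.rpow_neg (by positivity), Real.rpow_neg (by positivity), ← div_eq_mul_inv,
    inv_le_comm₀ (by positivity) (by positivity), inv_div, div_le_iff₀ (by positivity),
    mul_comm, ← Real.mul_rpow (by positivity) (by positivity)]
  exact Real.rpow_le_rpow (by positivity) hv hL

lemma lintegral_weighted_swap {X Y Z : Type*} [MeasurableSpace X] [MeasurableSpace Y]
    [MeasurableSpace Z] {μ : Measure X} {ρ : Measure Y} {ν : Measure Z} [SFinite μ] [SFinite ρ]
    [SFinite ν] {w : X → ℝ≥0∞} (hw : Measurable w) (hwtop : ∀ x, w x ≠ ∞) {T : X → Y → Z → ℝ≥0∞}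
    (hT : Measurable fun q : X × Y × Z => T q.1 q.2.1 q.2.2) {D : ℝ≥0∞} (hD : D ≠ ∞) :
    ∫⁻ u, ∫⁻ x, D * (w x * ∫⁻ v, T x u v ∂ν) ∂μ ∂ρ =
      D * ∫⁻ x, ∫⁻ v, w x * ∫⁻ u, T x u v ∂ρ ∂ν ∂μ := by
  have hm : Measurable fun q : Y × X => ∫⁻ v, T q.2 q.1 v ∂ν :=
    Measurable.lintegral_prod_right' (f := fun q : (Y × X) × Z => T q.1.2 q.1.1 q.2)
      (hT.comp (measurable_fst.snd.prodMk (measurable_fst.fst.prodMk measurable_snd)))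
  rw [lintegral_lintegral_swap (((hw.comp measurable_snd).mul hm).const_mul D).aemeasurable,
    ← lintegral_const_mul' _ _ hD]
  refine lintegral_congr fun x => ?_
  rw [lintegral_const_mul' _ _ hD, lintegral_const_mul' _ _ (hwtop x),
    lintegral_const_mul' _ _ (hwtop x), lintegral_lintegral_swap]
  exact (hT.comp (measurable_const.prodMk (measurable_fst.prodMk measurable_snd))).aemeasurable

/-- The single-scale square function estimate. The weight may belong to a cube of any side `M ≥ R`,
and the constant depends on neither `R` nor `M`. -/
lemma lintegral_sum_fourierInv_le (d : ℕ) {p : ℝ} (hp : 2 < p) {κ : ℝ} (hκ : (d : ℝ) < κ)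
    {C : ℝ} (hC : 0 < C) :
    ∃ K : ℝ≥0, ∀ (N : ℕ) (S : Finset (Fin d → ℕ)), IsLambdaSet p C N S →
      ∀ (R M : ℝ), 0 < R → R ≤ M →
      ∀ (c a : EuclideanSpace ℝ (Fin d)) (h : (Fin d → ℕ) → EuclideanSpace ℝ (Fin d) → ℂ),
      (∀ s ∈ S, Integrable (h s)) →
      (∀ s ∈ S, Function.support (h s) ⊆ cornerCube (a + R⁻¹ • toPoint s) R⁻¹) →
      ∫⁻ x, ENNReal.ofReal (weight κ c M x) * ‖∑ s ∈ S, 𝓕⁻ (h s) x‖ₑ ^ p ≤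
        K * ∫⁻ x, ENNReal.ofReal (weight κ c M x) *
          (∑ s ∈ S, ‖𝓕⁻ (h s) x‖ₑ ^ (2 : ℝ)) ^ (p / 2) := by
  have hp0 : 0 < p := by linarith
  have hκ0 : 0 ≤ κ := (Nat.cast_nonneg d).trans hκ.le
  -- The decay `L` leaves an integrable kernel after the loss of a factor `(1 + |v|) ^ κ`.
  set L : ℝ := κ + (d + 1) with hL
  obtain ⟨B, hB⟩ := enorm_sum_fourierInv_le d (L := L) (by positivity)
  set ν := decayMeasure d L with hν
  have hνtop : ν Set.univ ≠ ∞ := by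
    rw [← lintegral_one, hν, lintegral_decayMeasure L measurable_const]
    simpa using (lintegral_one_add_norm_lt_top (d := d) (r := L) (by linarith)).ne
  have hνκ : ∫⁻ v, ENNReal.ofReal ((1 + ‖v‖) ^ κ) ∂ν ≠ ∞ := by
    rw [hν, lintegral_decayMeasure L (continuous_one_add_norm_rpow κ).measurable.ennreal_ofReal]
    refine ne_of_eq_of_ne (lintegral_congr fun v => ?_)
      (lintegral_one_add_norm_lt_top (d := d) (r := d + 1) (by linarith)).ne
    rw [← ENNReal.ofReal_mul (by positivity), ← Real.rpow_add (by positivity)]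
    congr 2
    simp only [hL]
    ring
  set D : ℝ≥0∞ := ENNReal.ofReal ((1 + √d) ^ κ) with hD
  set A : ℝ≥0∞ := (B : ℝ≥0∞) ^ p * ν Set.univ ^ (p - 1) with hA
  set K : ℝ≥0∞ := D * (A * (ENNReal.ofReal C ^ p *
    ∫⁻ v, ENNReal.ofReal ((1 + ‖v‖) ^ κ) ∂ν)) with hK
  have hAtop : A ≠ ∞ := ENNReal.mul_ne_top (ENNReal.rpow_ne_top_of_nonneg hp0.le
    ENNReal.coe_ne_top) (ENNReal.rpow_ne_top_of_nonneg (by linarith) hνtop)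
  have hCtop : ENNReal.ofReal C ^ p ≠ ∞ :=
    ENNReal.rpow_ne_top_of_nonneg hp0.le ENNReal.ofReal_ne_top
  have hKtop : K ≠ ∞ := ENNReal.mul_ne_top ENNReal.ofReal_ne_top
    (ENNReal.mul_ne_top hAtop (ENNReal.mul_ne_top hCtop hνκ))
  have hDA : D * A ≠ ∞ := ENNReal.mul_ne_top ENNReal.ofReal_ne_top hAtop
  refine ⟨K.toNNReal, fun N S hS R M hR hRM c a h hi hs => ?_⟩
  rw [ENNReal.coe_toNNReal hKtop]
  have hM : 0 < M := hR.trans_le hRM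
  set w : EuclideanSpace ℝ (Fin d) → ℝ≥0∞ := fun x => ENNReal.ofReal (weight κ c M x) with hw
  set Q := cornerCube (0 : EuclideanSpace ℝ (Fin d)) 1 with hQ
  set F : EuclideanSpace ℝ (Fin d) → ℂ := fun x => ∑ s ∈ S, 𝓕⁻ (h s) x with hF
  set G : EuclideanSpace ℝ (Fin d) → ℝ≥0∞ :=
    fun x => (∑ s ∈ S, ‖𝓕⁻ (h s) x‖ₑ ^ (2 : ℝ)) ^ (p / 2) with hG
  set T : EuclideanSpace ℝ (Fin d) → EuclideanSpace ℝ (Fin d) → EuclideanSpace ℝ (Fin d) → ℝ≥0∞ :=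
    fun x u v => ‖∑ s ∈ S, (Real.fourierChar (inner ℝ u (toPoint s)) : ℂ) *
      ((Real.fourierChar (inner ℝ v (toPoint s)) : ℂ) * 𝓕⁻ (h s) (x - R • v))‖ₑ ^ p with hT
  have hwm : Measurable w := (continuous_weight κ c hM).measurable.ennreal_ofReal
  have hGm : Measurable G := by
    refine Measurable.pow_const (Finset.measurable_sum _ fun s hsS => ?_) _
    exact (continuous_fourierInv (hi s hsS)).enorm.measurable.pow_const _
  have hTm : Measurable fun q : EuclideanSpace ℝ (Fin d) × EuclideanSpace ℝ (Fin d) ×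
      EuclideanSpace ℝ (Fin d) => T q.1 q.2.1 q.2.2 := by
    refine Measurable.pow_const (Continuous.measurable (Continuous.enorm ?_)) _
    refine continuous_finsetSum _ fun s hsS => ?_
    exact (continuous_fourierChar_coe.comp (by fun_prop)).mul
      ((continuous_fourierChar_coe.comp (by fun_prop)).mul
        ((continuous_fourierInv (hi s hsS)).comp (by fun_prop)))
  have hFT : ∀ x, ∀ u ∈ Q, ‖F (x + R • u)‖ₑ ^ p ≤ A * ∫⁻ v, T x u v ∂ν := by
    intro x u hu
    refine (ENNReal.rpow_le_rpow (hB S R hR a h hi hs x u hu) hp0.le).trans ?_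
    rw [ENNReal.mul_rpow_of_nonneg _ _ hp0.le, hA, mul_assoc]
    gcongr
    refine rpow_lintegral_le ν ?_ (by linarith)
    refine (Continuous.measurable (Continuous.enorm ?_)).aemeasurable
    refine continuous_finsetSum _ fun s hsS => continuous_const.mul ?_
    exact (continuous_fourierChar_coe.comp (by fun_prop)).mul
      ((continuous_fourierInv (hi s hsS)).comp (by fun_prop))
  have hTG : ∀ x v, ∫⁻ u in Q, T x u v ≤ ENNReal.ofReal C ^ p * G (x - R • v) := by
    intro x v
    refine (hS.lintegral_le hp hC _).trans_eq ?_
    simp only [hG, enorm_mul]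
    congr 3 with s
    rw [enorm_circle_coe, one_mul]
  have hvol : volume Q = 1 := by simp [hQ, volume_cornerCube]
  -- The integral is translation invariant, so it may be averaged over the shifts `R u`, `u ∈ Q`.
  calc ∫⁻ x, w x * ‖F x‖ₑ ^ p
      = ∫⁻ u in Q, ∫⁻ x, w (x + R • u) * ‖F (x + R • u)‖ₑ ^ p := by
        have : ∀ u : EuclideanSpace ℝ (Fin d), ∫⁻ x, w (x + R • u) * ‖F (x + R • u)‖ₑ ^ p =
            ∫⁻ x, w x * ‖F x‖ₑ ^ p := fun u =>
          lintegral_add_right_eq_self (fun x => w x * ‖F x‖ₑ ^ p) (R • u)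
        simp [this, hvol]
    _ ≤ ∫⁻ u in Q, ∫⁻ x, (D * A) * (w x * ∫⁻ v, T x u v ∂ν) := by
        refine setLIntegral_mono' (measurableSet_cornerCube _ _) fun u hu =>
          lintegral_mono fun x => ?_
        calc w (x + R • u) * ‖F (x + R • u)‖ₑ ^ p
            ≤ (D * w x) * (A * ∫⁻ v, T x u v ∂ν) := by
              refine mul_le_mul' ?_ (hFT x u hu)
              rw [hD, hw, ← ENNReal.ofReal_mul (by positivity)]
              refine ENNReal.ofReal_le_ofReal ((weight_add_smul_le hκ0 c hR hRM x u).trans ?_)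
              have := (weight_pos κ c hM x).le
              have := norm_le_of_mem_cornerCube hu
              gcongr
          _ = _ := by ring
    _ = (D * A) * ∫⁻ x, (∫⁻ v, (w x * ∫⁻ u in Q, T x u v) ∂ν) := by
        rw [lintegral_weighted_swap hwm (fun _ => ENNReal.ofReal_ne_top) hTm hDA]
    _ ≤ (D * A) * ∫⁻ x, (∫⁻ v, w x * (ENNReal.ofReal C ^ p * G (x - R • v)) ∂ν) := by
        gcongr (D * A) * ?_
        refine lintegral_mono fun x => lintegral_mono fun v => ?_
        exact mul_le_mul_right (hTG x v) _
    _ = (D * A * ENNReal.ofReal C ^ p) * ∫⁻ v, (∫⁻ x, w (x + R • v) * G x) ∂ν := by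
        rw [mul_assoc (D * A), ← lintegral_const_mul' _ _ hCtop, lintegral_lintegral_swap]
        · congr 1
          refine lintegral_congr fun v => ?_
          rw [← lintegral_add_right_eq_self _ (R • v), ← lintegral_const_mul' _ _ hCtop]
          refine lintegral_congr fun x => ?_
          rw [add_sub_cancel_right]
          ring
        · exact ((hwm.comp measurable_fst).mul
            ((hGm.comp (by fun_prop)).const_mul _)).aemeasurable
    _ ≤ (D * A * ENNReal.ofReal C ^ p) *
          ∫⁻ v, (∫⁻ x, ENNReal.ofReal ((1 + ‖v‖) ^ κ) * (w x * G x)) ∂ν := by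
        gcongr (D * A * ENNReal.ofReal C ^ p) * ?_
        refine lintegral_mono fun v => lintegral_mono fun x => ?_
        rw [← mul_assoc]
        refine mul_le_mul_left ?_ _
        simp only [hw]
        rw [← ENNReal.ofReal_mul (by positivity)]
        exact ENNReal.ofReal_le_ofReal (weight_add_smul_le hκ0 c hR hRM x v)
    _ = K * ∫⁻ x, w x * G x := by
        have : ∀ v : EuclideanSpace ℝ (Fin d),
            ∫⁻ x, ENNReal.ofReal ((1 + ‖v‖) ^ κ) * (w x * G x) =
            ENNReal.ofReal ((1 + ‖v‖) ^ κ) * ∫⁻ x, w x * G x := fun v =>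
          lintegral_const_mul _ (hwm.mul hGm)
        simp only [this]
        rw [lintegral_mul_const _ (continuous_one_add_norm_rpow κ).measurable.ennreal_ofReal, hK]
        ring

lemma weightedNorm_rpow {κ p : ℝ} (hp : 0 < p) (c : EuclideanSpace ℝ (Fin d)) {R : ℝ} (hR : 0 < R)
    {F : EuclideanSpace ℝ (Fin d) → ℂ} (hF : Continuous F) :
    weightedNorm κ p c R F ^ p = ∫⁻ x, ENNReal.ofReal (weight κ c R x) * ‖F x‖ₑ ^ p := by
  rw [weightedNorm, eLpNorm_eq_lintegral_rpow_enorm_toReal (by simpa using hp)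
    ENNReal.ofReal_ne_top, ENNReal.toReal_ofReal hp.le, ← ENNReal.rpow_mul,
    one_div_mul_cancel hp.ne', ENNReal.rpow_one, lintegral_withDensity_eq_lintegral_mul _
    (continuous_weight κ c hR).measurable.ennreal_ofReal (hF.enorm.measurable.pow_const p)]
  rfl

/-- Minkowski's inequality: an `L^p` bound on a square function, `p ≥ 2`, is stronger than an
`ℓ²` bound on the `L^p` norms. -/
lemma lintegral_squareFunction_le {κ p : ℝ} (hp : 2 < p) (c : EuclideanSpace ℝ (Fin d)) {R : ℝ}
    (hR : 0 < R) {ι : Type*} (S : Finset ι) {F : ι → EuclideanSpace ℝ (Fin d) → ℂ}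
    (hF : ∀ s ∈ S, Continuous (F s)) :
    ∫⁻ x, ENNReal.ofReal (weight κ c R x) * (∑ s ∈ S, ‖F s x‖ₑ ^ (2 : ℝ)) ^ (p / 2) ≤
      (∑ s ∈ S, weightedNorm κ p c R (F s) ^ (2 : ℝ)) ^ (p / 2) := by
  have hp0 : 0 < p := by linarith
  have hp2 : 0 < p / 2 := by linarith
  have hwm : Measurable fun x => ENNReal.ofReal (weight κ c R x) :=
    (continuous_weight κ c hR).measurable.ennreal_ofReal
  set μ := (volume : Measure (EuclideanSpace ℝ (Fin d))).withDensity
    fun x => ENNReal.ofReal (weight κ c R x) with hμ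
  have hm : ∀ s ∈ S, Measurable fun x => ‖F s x‖ₑ ^ (2 : ℝ) := fun s hs =>
    (hF s hs).enorm.measurable.pow_const _
  have h1 := eLpNorm'_sum_le (μ := μ) (q := p / 2) (s := S)
    (f := fun s x => ‖F s x‖ₑ ^ (2 : ℝ)) (fun s hs => (hm s hs).aestronglyMeasurable)
    (by linarith)
  have h2 : ∀ s ∈ S, eLpNorm' (fun x => ‖F s x‖ₑ ^ (2 : ℝ)) (p / 2) μ =
      weightedNorm κ p c R (F s) ^ (2 : ℝ) := by
    intro s hs
    rw [eLpNorm', weightedNorm, eLpNorm_eq_lintegral_rpow_enorm_toReal (by simpa using hp0)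
      ENNReal.ofReal_ne_top, ENNReal.toReal_ofReal hp0.le, ← ENNReal.rpow_mul]
    congr 1
    · refine lintegral_congr fun x => ?_
      rw [enorm_eq_self, ← ENNReal.rpow_mul]
      congr 1
      ring
    · field_simp
  rw [Finset.sum_congr rfl h2, eLpNorm', one_div, ENNReal.rpow_inv_le_iff hp2] at h1
  refine le_trans (le_of_eq ?_) h1
  rw [hμ, lintegral_withDensity_eq_lintegral_mul _ hwm]
  · refine lintegral_congr fun x => ?_
    simp only [Pi.mul_apply, Finset.sum_apply, enorm_eq_self]
  · simp only [Finset.sum_apply, enorm_eq_self]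
    exact (Finset.measurable_sum _ hm).pow_const _

/-- Decoupling at a single scale, with the weight of any cube whose side is at least the scale
dual to the frequency cubes. -/
lemma weightedNorm_sum_fourierInv_le (d : ℕ) {p : ℝ} (hp : 2 < p) {κ : ℝ} (hκ : (d : ℝ) < κ)
    {C : ℝ} (hC : 0 < C) :
    ∃ K : ℝ≥0, ∀ (N : ℕ) (S : Finset (Fin d → ℕ)), IsLambdaSet p C N S →
      ∀ (R M : ℝ), 0 < R → R ≤ M →
      ∀ (c a : EuclideanSpace ℝ (Fin d)) (h : (Fin d → ℕ) → EuclideanSpace ℝ (Fin d) → ℂ),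
      (∀ s ∈ S, Integrable (h s)) →
      (∀ s ∈ S, Function.support (h s) ⊆ cornerCube (a + R⁻¹ • toPoint s) R⁻¹) →
      weightedNorm κ p c M (fun x => ∑ s ∈ S, 𝓕⁻ (h s) x) ^ (2 : ℝ) ≤
        K * ∑ s ∈ S, weightedNorm κ p c M (𝓕⁻ (h s)) ^ (2 : ℝ) := by
  have hp0 : 0 < p := by linarith
  obtain ⟨K, hK⟩ := lintegral_sum_fourierInv_le d hp hκ hC
  refine ⟨K ^ (2 / p), fun N S hS R M hR hRM c a h hi hs => ?_⟩
  have hM := hR.trans_le hRM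
  have hc : ∀ s ∈ S, Continuous (𝓕⁻ (h s)) := fun s hsS => continuous_fourierInv (hi s hsS)
  have h1 := (hK N S hS R M hR hRM c a h hi hs).trans
    (mul_le_mul_right (lintegral_squareFunction_le (κ := κ) hp c hM S hc) _)
  rw [← weightedNorm_rpow hp0 c hM (continuous_finsetSum _ hc)] at h1
  have h2 := ENNReal.rpow_le_rpow h1 (show 0 ≤ 2 / p by positivity)
  rw [← ENNReal.rpow_mul, ENNReal.mul_rpow_of_nonneg _ _ (by positivity), ← ENNReal.rpow_mul,
    mul_div_cancel₀ _ hp0.ne', show p / 2 * (2 / p) = 1 by field_simp, ENNReal.rpow_one] at h2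
  rwa [ENNReal.coe_rpow_of_nonneg _ (by positivity)]

/-! ### Summing the weights of a tiling by unit cubes -/

/-- The weight is symmetric in its centre and its argument. -/
lemma weight_comm (κ : ℝ) (c : EuclideanSpace ℝ (Fin d)) (R : ℝ) (x : EuclideanSpace ℝ (Fin d)) :
    weight κ c R x = weight κ x R c := by
  simp only [weight, norm_sub_rev]

/-- The ratio of the unit-scale weight to the weight at scale `N ≥ 1` is at most a constant times
`N ^ (-κ)` plus the unit-scale weight. -/
lemma one_add_rpow_neg_le {κ : ℝ} (hκ : 0 ≤ κ) {N r : ℝ} (hN : 1 ≤ N) (hr : 0 ≤ r) :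
    (1 + r) ^ (-κ) ≤ 2 ^ κ * ((N ^ (-κ) + (1 + r) ^ (-κ)) * (1 + r / N) ^ (-κ)) := by
  have hN0 : 0 < N := by linarith
  have hq : 0 < 1 + r / N := by positivity
  -- If `1 + r ≤ N`, the weight at scale `N` is at least `2 ^ (-κ)`; otherwise it is comparable to
  -- `N ^ κ * (1 + r) ^ (-κ)`.
  rcases le_total (1 + r) N with h | h
  · have h1 : 1 ≤ 2 ^ κ * (1 + r / N) ^ (-κ) := by
      rw [Real.rpow_neg hq.le, ← div_eq_mul_inv, one_le_div (by positivity)]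
      refine Real.rpow_le_rpow hq.le ?_ hκ
      have : r / N ≤ 1 := (div_le_one hN0).2 (by linarith)
      linarith
    have h2 : 0 ≤ N ^ (-κ) := by positivity
    have h3 : 0 ≤ (1 + r) ^ (-κ) := by positivity
    nlinarith
  · have h1 : (1 + r) ^ (-κ) ≤ 2 ^ κ * (N ^ (-κ) * (1 + r / N) ^ (-κ)) := by
      rw [← Real.mul_rpow hN0.le hq.le, mul_add, mul_div_cancel₀ _ hN0.ne', mul_one,
        Real.rpow_neg (by positivity), Real.rpow_neg (by positivity), ← div_eq_mul_inv,
        inv_le_comm₀ (by positivity) (by positivity), inv_div, div_le_iff₀ (by positivity),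
        ← Real.mul_rpow (by positivity) (by positivity)]
      exact Real.rpow_le_rpow (by positivity) (by linarith) hκ
    refine h1.trans ?_
    gcongr
    have : 0 ≤ (1 + r) ^ (-κ) := by positivity
    linarith

/-- The weight of a unit cube at `x` is comparable to the integral of `(1 + |x - y|) ^ (-κ)` over the
cube, and these integrals add up over the tiling. -/
lemma sum_weight_le_lintegral {κ : ℝ} (hκ : 0 ≤ κ) {𝓘 : Finset (EuclideanSpace ℝ (Fin d))}
    {c : EuclideanSpace ℝ (Fin d)} {R : ℝ} (h : IsUnitTiling 𝓘 c R)
    (x : EuclideanSpace ℝ (Fin d)) :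
    ∑ b ∈ 𝓘, ENNReal.ofReal (weight κ b 1 x) ≤
      ENNReal.ofReal ((1 + √d) ^ κ) * ∫⁻ y in cube c R, ENNReal.ofReal (weight κ x 1 y) := by
  have h1 : ∀ b ∈ 𝓘, ENNReal.ofReal (weight κ b 1 x) ≤ ∫⁻ y in interior (cube b 1),
      ENNReal.ofReal ((1 + √d) ^ κ) * ENNReal.ofReal (weight κ x 1 y) := by
    intro b _
    calc ENNReal.ofReal (weight κ b 1 x)
        = ∫⁻ _y in interior (cube b 1), ENNReal.ofReal (weight κ b 1 x) := by
          simp [volume_interior_cube]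
      _ ≤ _ := by
          refine setLIntegral_mono' isOpen_interior.measurableSet fun y hy => ?_
          rw [← ENNReal.ofReal_mul (by positivity), weight_comm κ b 1 x]
          refine ENNReal.ofReal_le_ofReal
            ((weight_le_mul_weight hκ x one_pos b y).trans ?_)
          have h2 := norm_sub_le_of_mem_cube zero_le_one (interior_subset hy)
          rw [mul_one, norm_sub_rev] at h2
          have := (weight_pos κ x one_pos y).le
          rw [div_one]
          gcongr
  refine (Finset.sum_le_sum h1).trans ?_
  rw [← lintegral_biUnion_finset h.2 fun b _ => isOpen_interior.measurableSet,
    lintegral_const_mul' _ _ ENNReal.ofReal_ne_top]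
  gcongr
  rw [← h.1]
  exact Set.iUnion₂_mono fun b _ => interior_subset

/-- The function `(1 + |x - y|) ^ (-κ)` integrated over a large cube. The bound
`N ^ d * N ^ (-κ) ≤ 1` used here is where `κ > d` enters besides integrability. -/
lemma lintegral_cube_weight_le (d : ℕ) {κ : ℝ} (hκ : (d : ℝ) < κ) :
    ∃ K : ℝ≥0, ∀ (c x : EuclideanSpace ℝ (Fin d)) (N : ℝ), 1 ≤ N →
      ∫⁻ y in cube c N, ENNReal.ofReal (weight κ x 1 y) ≤ K * ENNReal.ofReal (weight κ c N x) := by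
  have hκ0 : 0 ≤ κ := (Nat.cast_nonneg d).trans hκ.le
  set I := ∫⁻ v : EuclideanSpace ℝ (Fin d), ENNReal.ofReal ((1 + ‖v‖) ^ (-κ)) with hI
  have hItop : I ≠ ∞ := (lintegral_one_add_norm_lt_top hκ).ne
  set D : ℝ := 2 ^ κ * (1 + √d) ^ κ with hD
  refine ⟨(ENNReal.ofReal D * (1 + I)).toNNReal, fun c x N hN => ?_⟩
  rw [ENNReal.coe_toNNReal (ENNReal.mul_ne_top ENNReal.ofReal_ne_top (by finiteness))]
  have hN0 : 0 < N := by linarith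
  have hpt : ∀ y ∈ cube c N, weight κ x 1 y ≤
      D * weight κ c N x * (N ^ (-κ) + (1 + ‖y - x‖) ^ (-κ)) := by
    intro y hy
    have h1 : weight κ x N y ≤ (1 + √d) ^ κ * weight κ c N x := by
      rw [weight_comm κ c N x]
      refine (weight_le_mul_weight hκ0 x hN0 y c).trans ?_
      have := (weight_pos κ x hN0 c).le
      have h2 : ‖y - c‖ / N ≤ √d :=
        (div_le_iff₀ hN0).2 (norm_sub_le_of_mem_cube hN0.le hy)
      gcongr
    calc weight κ x 1 y = (1 + ‖y - x‖) ^ (-κ) := by rw [weight, div_one]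
      _ ≤ 2 ^ κ * ((N ^ (-κ) + (1 + ‖y - x‖) ^ (-κ)) * weight κ x N y) :=
        one_add_rpow_neg_le hκ0 hN (norm_nonneg _)
      _ ≤ 2 ^ κ * ((N ^ (-κ) + (1 + ‖y - x‖) ^ (-κ)) * ((1 + √d) ^ κ * weight κ c N x)) := by
        gcongr
      _ = _ := by rw [hD]; ring
  have hw := (weight_pos κ c hN0 x).le
  have hDpos : 0 ≤ D := by positivity
  have hvol : ENNReal.ofReal (N ^ (-κ)) * volume (cube c N) ≤ 1 := by
    rw [volume_cube, ← ENNReal.ofReal_pow hN0.le, ← ENNReal.ofReal_mul (by positivity),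
      ← Real.rpow_natCast, ← Real.rpow_add hN0]
    exact ENNReal.ofReal_le_one.2 (Real.rpow_le_one_of_one_le_of_nonpos hN (by linarith))
  have hint : ∫⁻ y in cube c N, ENNReal.ofReal ((1 + ‖y - x‖) ^ (-κ)) ≤ I :=
    (setLIntegral_le_lintegral _ _).trans_eq
      (lintegral_sub_right_eq_self (fun v => ENNReal.ofReal ((1 + ‖v‖) ^ (-κ))) x)
  calc ∫⁻ y in cube c N, ENNReal.ofReal (weight κ x 1 y)
      ≤ ∫⁻ y in cube c N, ENNReal.ofReal (D * weight κ c N x) *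
          (ENNReal.ofReal (N ^ (-κ)) + ENNReal.ofReal ((1 + ‖y - x‖) ^ (-κ))) := by
        refine setLIntegral_mono' (measurableSet_cube _ _) fun y hy => ?_
        rw [← ENNReal.ofReal_add (by positivity) (by positivity),
          ← ENNReal.ofReal_mul (by positivity)]
        exact ENNReal.ofReal_le_ofReal (hpt y hy)
    _ = ENNReal.ofReal (D * weight κ c N x) * (ENNReal.ofReal (N ^ (-κ)) * volume (cube c N) +
          ∫⁻ y in cube c N, ENNReal.ofReal ((1 + ‖y - x‖) ^ (-κ))) := by
        rw [lintegral_const_mul' _ _ ENNReal.ofReal_ne_top, lintegral_add_left measurable_const,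
          setLIntegral_const]
    _ ≤ ENNReal.ofReal (D * weight κ c N x) * (1 + I) := by gcongr
    _ = _ := by
        rw [ENNReal.ofReal_mul hDpos]
        ring

/-- The weights of the unit cubes tiling a large cube add up to at most a constant times the
weight of the large cube; stated for the `p`-th powers of the weighted norms. -/
lemma sum_weightedNorm_rpow_le (d : ℕ) {p : ℝ} (hp : 0 < p) {κ : ℝ} (hκ : (d : ℝ) < κ) :
    ∃ K : ℝ≥0, ∀ (𝓘 : Finset (EuclideanSpace ℝ (Fin d))) (c : EuclideanSpace ℝ (Fin d)) (N : ℝ),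
      1 ≤ N → IsUnitTiling 𝓘 c N → ∀ F : EuclideanSpace ℝ (Fin d) → ℂ, Continuous F →
      ∑ b ∈ 𝓘, weightedNorm κ p b 1 F ^ p ≤ K * weightedNorm κ p c N F ^ p := by
  have hκ0 : 0 ≤ κ := (Nat.cast_nonneg d).trans hκ.le
  obtain ⟨K, hK⟩ := lintegral_cube_weight_le d hκ
  refine ⟨((1 + √d) ^ κ).toNNReal * K, fun 𝓘 c N hN h F hF => ?_⟩
  have hN0 : 0 < N := by linarith
  have hm : ∀ b : EuclideanSpace ℝ (Fin d), Measurable fun x =>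
      ENNReal.ofReal (weight κ b 1 x) * ‖F x‖ₑ ^ p := fun b =>
    (continuous_weight κ b one_pos).measurable.ennreal_ofReal.mul
      (hF.enorm.measurable.pow_const p)
  rw [weightedNorm_rpow hp c hN0 hF, Finset.sum_congr rfl fun b _ =>
    weightedNorm_rpow (κ := κ) hp b one_pos hF, ← lintegral_finsetSum _ fun b _ => hm b,
    ← lintegral_const_mul' _ _ ENNReal.coe_ne_top]
  refine lintegral_mono fun x => ?_
  simp only
  rw [← Finset.sum_mul, ← mul_assoc]
  gcongr
  refine (sum_weight_le_lintegral hκ0 h x).trans ?_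
  rw [ENNReal.coe_mul, mul_assoc]
  gcongr
  · exact le_rfl
  · exact hK c x N hN

/-! ### The combinatorics of the Cantor construction -/

lemma scale_pos {n : ℕ → ℕ} (hn : ∀ j, 0 < n j) (k : ℕ) : 0 < scale n k :=
  Finset.prod_pos fun j _ => hn j

lemma scale_succ (n : ℕ → ℕ) (k : ℕ) : scale n (k + 1) = scale n k * n k :=
  Finset.prod_range_succ n k

lemma scale_dvd (n : ℕ → ℕ) {j k : ℕ} (h : j ≤ k) : scale n j ∣ scale n k :=
  Finset.prod_dvd_prod_of_subset _ _ _ (Finset.range_mono h)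

lemma mem_corners_succ {n : ℕ → ℕ} {S : ℕ → EuclideanSpace ℝ (Fin d) → Finset (Fin d → ℕ)}
    {k : ℕ} {b : EuclideanSpace ℝ (Fin d)} :
    b ∈ corners n S (k + 1) ↔ ∃ a ∈ corners n S k, ∃ s ∈ S k a,
      a + ((scale n (k + 1) : ℝ)⁻¹) • toPoint s = b := by
  simp [corners]

lemma child_mul_scale {n : ℕ → ℕ} (hn : ∀ j, 0 < n j) (k : ℕ) (a : EuclideanSpace ℝ (Fin d))
    (s : Fin d → ℕ) (i : Fin d) :
    (a + ((scale n (k + 1) : ℝ)⁻¹) • toPoint s) i * scale n (k + 1) =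
      a i * scale n k * n k + s i := by
  have : (scale n (k + 1) : ℝ) ≠ 0 := by exact_mod_cast (scale_pos hn _).ne'
  simp only [PiLp.add_apply, PiLp.smul_apply, toPoint, smul_eq_mul]
  rw [add_mul, mul_right_comm, inv_mul_cancel₀ this, one_mul, scale_succ]
  push_cast
  ring

lemma corners_mul_scale {n : ℕ → ℕ} (hn : ∀ j, 0 < n j)
    {S : ℕ → EuclideanSpace ℝ (Fin d) → Finset (Fin d → ℕ)} (k : ℕ) :
    ∀ a ∈ corners n S k, ∀ i, ∃ m : ℕ, a i * scale n k = m := by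
  induction k with
  | zero =>
    intro a ha i
    rw [corners, Finset.mem_singleton] at ha
    exact ⟨0, by simp [ha]⟩
  | succ k ih =>
    intro b hb i
    obtain ⟨a, ha, s, -, rfl⟩ := mem_corners_succ.1 hb
    obtain ⟨m, hm⟩ := ih a ha i
    exact ⟨m * n k + s i, by rw [child_mul_scale hn, hm]; push_cast; ring⟩

/-- A corner of stage `k + 1` determines its parent and its digit vector: times `N_{k+1}`, the
coordinates are `m * n + s` with `0 ≤ s < n`. -/
lemma child_injective {n : ℕ → ℕ} (hn : ∀ j, 0 < n j) {k : ℕ} {a a' : EuclideanSpace ℝ (Fin d)}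
    (ha : ∀ i, ∃ m : ℕ, a i * scale n k = m) (ha' : ∀ i, ∃ m : ℕ, a' i * scale n k = m)
    {s s' : Fin d → ℕ} (hs : ∀ i, s i < n k) (hs' : ∀ i, s' i < n k)
    (h : a + ((scale n (k + 1) : ℝ)⁻¹) • toPoint s = a' + ((scale n (k + 1) : ℝ)⁻¹) • toPoint s') :
    a = a' ∧ s = s' := by
  have hk : (scale n k : ℝ) ≠ 0 := by exact_mod_cast (scale_pos hn _).ne'
  have key : ∀ i, a i = a' i ∧ s i = s' i := by
    intro i
    obtain ⟨m, hm⟩ := ha i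
    obtain ⟨m', hm'⟩ := ha' i
    have h1 := congrArg (fun x : EuclideanSpace ℝ (Fin d) => x i * scale n (k + 1)) h
    simp only [child_mul_scale hn, hm, hm'] at h1
    have h2 : m * n k + s i = m' * n k + s' i := by exact_mod_cast h1
    have h3 : m = m' := by
      have h4 := congrArg (· / n k) h2
      simpa [Nat.add_div_of_dvd_right, Nat.div_eq_of_lt (hs i), Nat.div_eq_of_lt (hs' i),
        (hn k).ne', Nat.mul_div_cancel _ (hn k), Nat.mul_add_div (hn k), mul_comm] using h4
    subst h3
    exact ⟨mul_right_cancel₀ hk (hm.trans hm'.symm), by omega⟩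
  exact ⟨by ext i; exact (key i).1, funext fun i => (key i).2⟩

lemma stageCube_child_subset {n : ℕ → ℕ} (hn : ∀ j, 0 < n j) {k : ℕ}
    (a : EuclideanSpace ℝ (Fin d)) {s : Fin d → ℕ} (hs : ∀ i, s i < n k) :
    stageCube n (k + 1) (a + ((scale n (k + 1) : ℝ)⁻¹) • toPoint s) ⊆ stageCube n k a := by
  intro x hx i
  have hN : (0 : ℝ) < scale n (k + 1) := by exact_mod_cast scale_pos hn _
  have hN' : (0 : ℝ) < scale n k := by exact_mod_cast scale_pos hn _
  have hnk : (0 : ℝ) < n k := by exact_mod_cast hn k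
  have h := hx i
  simp only [PiLp.add_apply, PiLp.smul_apply, toPoint, smul_eq_mul] at h
  have h1 : (scale n (k + 1) : ℝ)⁻¹ * s i + (scale n (k + 1) : ℝ)⁻¹ ≤ (scale n k : ℝ)⁻¹ := by
    have h2 : (s i : ℝ) + 1 ≤ n k := by exact_mod_cast hs i
    calc _ = (scale n (k + 1) : ℝ)⁻¹ * (s i + 1) := by ring
      _ ≤ (scale n (k + 1) : ℝ)⁻¹ * n k := by gcongr
      _ = _ := by
        rw [scale_succ]
        push_cast
        field_simp
  have h3 : 0 ≤ (scale n (k + 1) : ℝ)⁻¹ * s i := by positivity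
  constructor <;> linarith

lemma stage_antitone {p C : ℝ} {n : ℕ → ℕ}
    {S : ℕ → EuclideanSpace ℝ (Fin d) → Finset (Fin d → ℕ)} (h : IsLambdaCantor p C n S) :
    Antitone (stage n S) := by
  refine antitone_nat_of_succ_le fun k x hx => ?_
  simp only [stage, Set.mem_iUnion, exists_prop] at hx ⊢
  obtain ⟨b, hb, hxb⟩ := hx
  obtain ⟨a, ha, s, hs, rfl⟩ := mem_corners_succ.1 hb
  exact ⟨a, ha, stageCube_child_subset h.1 a ((h.2 k a ha).1 s hs) hxb⟩

lemma sum_corners_succ {p C : ℝ} {n : ℕ → ℕ}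
    {S : ℕ → EuclideanSpace ℝ (Fin d) → Finset (Fin d → ℕ)} (h : IsLambdaCantor p C n S) (k : ℕ)
    (X : EuclideanSpace ℝ (Fin d) → ℝ≥0∞) :
    ∑ b ∈ corners n S (k + 1), X b =
      ∑ a ∈ corners n S k, ∑ s ∈ S k a, X (a + ((scale n (k + 1) : ℝ)⁻¹) • toPoint s) := by
  rw [corners, Finset.sum_biUnion]
  · refine Finset.sum_congr rfl fun a ha => Finset.sum_image fun s hs s' hs' hss => ?_
    have hc := corners_mul_scale h.1 k a ha
    exact (child_injective h.1 hc hc ((h.2 k a ha).1 s hs) ((h.2 k a ha).1 s' hs') hss).2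
  · intro a ha a' ha' hne
    rw [Function.onFun, Finset.disjoint_left]
    intro b hb hb'
    obtain ⟨s, hs, rfl⟩ := Finset.mem_image.1 hb
    obtain ⟨s', hs', hss⟩ := Finset.mem_image.1 hb'
    exact hne (child_injective h.1 (corners_mul_scale h.1 k a ha) (corners_mul_scale h.1 k a' ha')
      ((h.2 k a ha).1 s hs) ((h.2 k a' ha').1 s' hs') hss.symm).1

/-- The union of the hyperplanes `x i ∈ N⁻¹ ℤ`; it contains the boundaries of all the cubes of the
grid of side `N⁻¹`. -/
def gridHyperplanes (d N : ℕ) : Set (EuclideanSpace ℝ (Fin d)) :=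
  {x | ∃ i, ∃ m : ℤ, x i * N = m}

lemma volume_gridHyperplanes (d : ℕ) {N : ℕ} (hN : 0 < N) :
    volume (gridHyperplanes d N) = 0 := by
  have hN' : (N : ℝ) ≠ 0 := by exact_mod_cast hN.ne'
  have : gridHyperplanes d N ⊆ ⋃ i : Fin d, ⋃ m : ℤ,
      (fun x : EuclideanSpace ℝ (Fin d) => WithLp.ofLp x) ⁻¹' {x | x i = m / N} := by
    rintro x ⟨i, m, hm⟩
    simp only [Set.mem_iUnion, Set.mem_preimage, Set.mem_ofPred_eq]
    exact ⟨i, m, by rw [eq_div_iff hN', hm]⟩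
  refine measure_mono_null this (measure_iUnion_null fun i => measure_iUnion_null fun m => ?_)
  rw [volume_ofLp_preimage _ (measurableSet_eq_fun (by fun_prop) (by fun_prop)), volume_pi]
  exact Measure.pi_hyperplane _ i _

lemma gridHyperplanes_mono {N N' : ℕ} (h : N ∣ N') :
    gridHyperplanes d N ⊆ gridHyperplanes d N' := by
  rintro x ⟨i, m, hm⟩
  obtain ⟨q, rfl⟩ := h
  exact ⟨i, m * q, by push_cast; rw [← hm]; ring⟩

/-- Off the grid hyperplanes a point lies in at most one cube of the grid. -/
lemma eq_of_mem_cornerCube {N : ℕ} (hN : 0 < N) {x a a' : EuclideanSpace ℝ (Fin d)}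
    (hx : x ∉ gridHyperplanes d N) (ha : ∀ i, ∃ m : ℕ, a i * N = m)
    (ha' : ∀ i, ∃ m : ℕ, a' i * N = m) (hxa : x ∈ cornerCube a (N : ℝ)⁻¹)
    (hxa' : x ∈ cornerCube a' (N : ℝ)⁻¹) : a = a' := by
  have hN' : (0 : ℝ) < N := by exact_mod_cast hN
  have key : ∀ b : EuclideanSpace ℝ (Fin d), x ∈ cornerCube b (N : ℝ)⁻¹ → ∀ i, ∀ m : ℕ,
      b i * N = m → ⌊x i * N⌋ = m := by
    intro b hb i m hm
    have h1 := mul_le_mul_of_nonneg_right (hb i).1 hN'.le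
    have h2 := mul_le_mul_of_nonneg_right (hb i).2 hN'.le
    rw [add_mul, inv_mul_cancel₀ hN'.ne', hm] at h2
    rw [hm] at h1
    rw [Int.floor_eq_iff]
    refine ⟨by exact_mod_cast h1, lt_of_le_of_ne (by push_cast; linarith) fun h => hx ⟨i, m + 1, ?_⟩⟩
    rw [h]
    push_cast
    ring
  ext i
  obtain ⟨m, hm⟩ := ha i
  obtain ⟨m', hm'⟩ := ha' i
  have h1 : (m : ℤ) = m' := (key a hxa i m hm).symm.trans (key a' hxa' i m' hm')
  have h2 : m = m' := by exact_mod_cast h1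
  exact mul_right_cancel₀ hN'.ne' (by rw [hm, hm', h2])

/-! ### Decomposing into frequency pieces -/

lemma fourierInv_congr_ae {h h' : EuclideanSpace ℝ (Fin d) → ℂ} (hh : h =ᵐ[volume] h') :
    𝓕⁻ h = 𝓕⁻ h' := by
  ext x
  rw [Real.fourierInv_eq, Real.fourierInv_eq]
  refine integral_congr_ae ?_
  filter_upwards [hh] with ξ hξ
  rw [hξ]

lemma fourierInv_sum {ι : Type*} (S : Finset ι) {h : ι → EuclideanSpace ℝ (Fin d) → ℂ}
    (hh : ∀ s ∈ S, Integrable (h s)) :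
    𝓕⁻ (fun ξ => ∑ s ∈ S, h s ξ) = fun x => ∑ s ∈ S, 𝓕⁻ (h s) x := by
  ext x
  simp only [Real.fourierInv_eq, Finset.smul_sum]
  refine integral_finsetSum _ fun s hs => ?_
  simp only [Circle.smul_def, smul_eq_mul]
  exact (hh s hs).bdd_mul (c := 1)
    (continuous_fourierChar_coe.comp (by fun_prop)).aestronglyMeasurable
    (.of_forall fun _ => (Circle.norm_coe _).le)

/-- A piece of `g` is the sum of the pieces at the children of its cube. The cubes overlap only in
their boundaries, which lie in a null set. -/
lemma piece_eq_sum {p C : ℝ} {n : ℕ → ℕ}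
    {S : ℕ → EuclideanSpace ℝ (Fin d) → Finset (Fin d → ℕ)} (h : IsLambdaCantor p C n S) {k : ℕ}
    {g : EuclideanSpace ℝ (Fin d) → ℂ} (hg : Integrable g)
    (hs : Function.support g ⊆ stage n S (k + 1)) {a : EuclideanSpace ℝ (Fin d)}
    (ha : a ∈ corners n S k) :
    piece g (stageCube n k a) = fun x => ∑ s ∈ S k a,
      piece g (stageCube n (k + 1) (a + ((scale n (k + 1) : ℝ)⁻¹) • toPoint s)) x := by
  have hnull := volume_gridHyperplanes d (scale_pos h.1 (k + 1))
  unfold piece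
  rw [← fourierInv_sum (S k a) (h := fun s => (stageCube n (k + 1)
    (a + ((scale n (k + 1) : ℝ)⁻¹) • toPoint s)).indicator g)
    fun s _ => hg.indicator (measurableSet_cornerCube _ _)]
  refine fourierInv_congr_ae ?_
  filter_upwards [compl_mem_ae_iff.2 hnull] with x hx
  have hx' : x ∉ gridHyperplanes d (scale n k) := fun hx' =>
    hx (gridHyperplanes_mono (scale_dvd n k.le_succ) hx')
  by_cases hgx : g x = 0
  · have hz : ∀ t : Set (EuclideanSpace ℝ (Fin d)), t.indicator g x = 0 := fun t =>
      Set.indicator_apply_eq_zero.2 fun _ => hgx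
    rw [hz, Finset.sum_eq_zero fun s _ => hz _]
  have hxs := hs (Function.mem_support.2 hgx)
  simp only [stage, Set.mem_iUnion, exists_prop] at hxs
  obtain ⟨b, hb, hxb⟩ := hxs
  obtain ⟨a', ha', s', hs', rfl⟩ := mem_corners_succ.1 hb
  have hxa' := stageCube_child_subset h.1 a' ((h.2 k a' ha').1 s' hs') hxb
  by_cases hxa : x ∈ stageCube n k a
  · obtain rfl : a = a' := eq_of_mem_cornerCube (scale_pos h.1 k) hx' (corners_mul_scale h.1 k a ha)
      (corners_mul_scale h.1 k a' ha') hxa hxa'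
    rw [Set.indicator_of_mem hxa, Finset.sum_eq_single_of_mem s' hs', Set.indicator_of_mem hxb]
    intro s hsS hne
    refine Set.indicator_of_notMem (fun hxs => hne ?_) _
    have hc := corners_mul_scale h.1 k a ha
    exact (child_injective h.1 hc hc ((h.2 k a ha).1 s hsS) ((h.2 k a ha).1 s' hs')
      (eq_of_mem_cornerCube (scale_pos h.1 (k + 1)) hx
        (corners_mul_scale h.1 (k + 1) _ (mem_corners_succ.2 ⟨a, ha, s, hsS, rfl⟩))
        (corners_mul_scale h.1 (k + 1) _ hb) hxs hxb)).2
  · rw [Set.indicator_of_notMem hxa, eq_comm]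
    refine Finset.sum_eq_zero fun s hsS => Set.indicator_of_notMem (fun hxs => hxa ?_) _
    exact stageCube_child_subset h.1 a ((h.2 k a ha).1 s hsS) hxs

/-- Multiscale decoupling with the weight of a single large cube. -/
lemma weightedNorm_fourierInv_le (d : ℕ) {p : ℝ} (hp : 2 < p) {κ : ℝ} (hκ : (d : ℝ) < κ)
    {C : ℝ} (hC : 0 < C) :
    ∃ K : ℝ≥0, ∀ (n : ℕ → ℕ) (S : ℕ → EuclideanSpace ℝ (Fin d) → Finset (Fin d → ℕ)),
      IsLambdaCantor p C n S → ∀ (k : ℕ) (c : EuclideanSpace ℝ (Fin d))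
      (g : EuclideanSpace ℝ (Fin d) → ℂ), Integrable g → Function.support g ⊆ stage n S k →
      ∀ j ≤ k, weightedNorm κ p c (scale n k) (𝓕⁻ g) ^ (2 : ℝ) ≤
        (K : ℝ≥0∞) ^ j * ∑ a ∈ corners n S j,
          weightedNorm κ p c (scale n k) (piece g (stageCube n j a)) ^ (2 : ℝ) := by
  obtain ⟨K, hK⟩ := weightedNorm_sum_fourierInv_le d hp hκ hC
  refine ⟨K, fun n S h k c g hg hs j => ?_⟩
  induction j with
  | zero =>
    intro _
    have hind : (stageCube n 0 0).indicator g = g := by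
      rw [Set.indicator_eq_self]
      refine (hs.trans (stage_antitone h (Nat.zero_le k))).trans_eq ?_
      simp [stage, corners]
    simp [corners, piece, hind]
  | succ j ih =>
    intro hj
    refine (ih (by omega)).trans ?_
    rw [pow_succ, mul_assoc, sum_corners_succ h j]
    refine mul_le_mul_right ?_ _
    rw [Finset.mul_sum]
    refine Finset.sum_le_sum fun a ha => ?_
    rw [piece_eq_sum h hg (hs.trans (stage_antitone h hj)) ha]
    have hpos : (0 : ℝ) < scale n (j + 1) := by exact_mod_cast scale_pos h.1 _
    exact hK _ _ (h.2 j a ha) _ _ hpos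
      (by exact_mod_cast Nat.le_of_dvd (scale_pos h.1 k) (scale_dvd n hj)) c a _
      (fun s _ => hg.indicator (measurableSet_cornerCube _ _))
      (fun s _ => Set.support_indicator_subset)

end CantorDecoupling

theorem proposition5p1 (d : ℕ) (hd : 1 ≤ d) (p : ℝ) (hp : 2 < p) (κ : ℝ) (hκ : (d : ℝ) < κ)
    (C : ℝ) (hC : 0 < C) :
    ∃ C₀ : ℝ≥0,
      ∀ (n : ℕ → ℕ) (S : ℕ → EuclideanSpace ℝ (Fin d) → Finset (Fin d → ℕ)),
        IsLambdaCantor p C n S →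
        ∀ (k : ℕ), 1 ≤ k →
        ∀ (c : EuclideanSpace ℝ (Fin d)) (𝓘 : Finset (EuclideanSpace ℝ (Fin d))),
          IsUnitTiling 𝓘 c (scale n k : ℝ) →
        ∀ (f g : EuclideanSpace ℝ (Fin d) → ℂ),
          HasFourierDensity f g → Function.support g ⊆ stage n S k →
          (∑ b ∈ 𝓘, weightedNorm κ p b 1 f ^ p) ^ (1 / p) ≤
            (C₀ : ℝ≥0∞) ^ k *
              (∑ a ∈ corners n S k,
                weightedNorm κ p c (scale n k : ℝ) (piece g (stageCube n k a)) ^ (2 : ℝ)) ^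
                (1 / 2 : ℝ) := by

  have hp0 : 0 < p := by linarith
  -- The constant of the tiling is paid only once; since `k ≥ 1`, it is absorbed into `C₀ ^ k`.
  obtain ⟨K, hK⟩ := weightedNorm_fourierInv_le d hp hκ hC
  obtain ⟨K', hK'⟩ := sum_weightedNorm_rpow_le d hp0 hκ
  refine ⟨max 1 (K' ^ (1 / p)) * K ^ (1 / 2 : ℝ), fun n S h k hk c 𝓘 hI f g hfg hs => ?_⟩
  have hscale : (1 : ℝ) ≤ scale n k := by exact_mod_cast scale_pos h.1 k
  have hf : ∀ b R, weightedNorm κ p b R f = weightedNorm κ p b R (𝓕⁻ g) := fun b R =>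
    eLpNorm_congr_ae ((withDensity_absolutelyContinuous _ _).ae_eq hfg.2)
  simp only [hf]
  set X := weightedNorm κ p c (scale n k) (𝓕⁻ g) with hX
  set Y := ∑ a ∈ corners n S k,
    weightedNorm κ p c (scale n k : ℝ) (piece g (stageCube n k a)) ^ (2 : ℝ) with hY
  have h1 : X ≤ ((K : ℝ≥0∞) ^ (1 / 2 : ℝ)) ^ k * Y ^ (1 / 2 : ℝ) := by
    have := ENNReal.rpow_le_rpow (hK n S h k c g hfg.1 hs k le_rfl)
      (show (0 : ℝ) ≤ 1 / 2 by norm_num)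
    rwa [← ENNReal.rpow_mul, mul_one_div_cancel two_ne_zero, ENNReal.rpow_one,
      ENNReal.mul_rpow_of_nonneg _ _ (by norm_num), ← ENNReal.rpow_natCast_mul, mul_comm (k : ℝ),
      ENNReal.rpow_mul_natCast] at this
  calc (∑ b ∈ 𝓘, weightedNorm κ p b 1 (𝓕⁻ g) ^ p) ^ (1 / p)
      ≤ (K' * X ^ p) ^ (1 / p) :=
        ENNReal.rpow_le_rpow (hK' 𝓘 c _ hscale hI _ (continuous_fourierInv hfg.1)) (by positivity)
    _ = (K' : ℝ≥0∞) ^ (1 / p) * X := by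
        rw [ENNReal.mul_rpow_of_nonneg _ _ (by positivity), ← ENNReal.rpow_mul,
          mul_one_div_cancel hp0.ne', ENNReal.rpow_one]
    _ ≤ (max 1 ((K' : ℝ≥0∞) ^ (1 / p))) ^ k *
          (((K : ℝ≥0∞) ^ (1 / 2 : ℝ)) ^ k * Y ^ (1 / 2 : ℝ)) := by
        gcongr
        exact (le_max_right _ _).trans (le_self_pow₀ (le_max_left _ _) (by omega))
    _ = _ := by
        rw [← mul_assoc, ← mul_pow, ENNReal.coe_mul, ENNReal.coe_max, ENNReal.coe_one,
          ENNReal.coe_rpow_of_nonneg _ (by positivity),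
          ENNReal.coe_rpow_of_nonneg _ (by positivity)]
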